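/- Let $L$ be a non-negative integer and let $\alpha\in\mathcal M_L(\mathbb C)$ satisfy $\alpha\neq 0$ and $\alpha^*\alpha<\mathbf 1_L$ (that is, $\mathbf 1_L-\alpha^*\alpha$ is positive definite). Put $\rho=(\mathbf 1_L-\alpha\alpha^*)^{1/2}$ and $\widetilde\rho=(\mathbf 1_L-\alpha^*\alpha)^{1/2}$, and for $z\in\mathbb S^1=\{z\in\mathbb C:|z|=1\}$ put $$\hat T_0(z)=\begin{pmatrix} z^{-1}\widetilde\rho^{-1} & \widetilde\rho^{-1}\alpha^*\\ \alpha\widetilde\rho^{-1} & z\rho^{-1}\end{pmatrix},\qquad \hat T_1=\begin{pmatrix}\widetilde\rho^{-1} & \widetilde\rho^{-1}\alpha^*\\ \alpha\widetilde\rho^{-1} & \rho^{-1}\end{pmatrix}.$$ Let $\mathrm U(L,L)=\{M\in\mathcal M_{2L}(\mathbb C): M^*\mathcal L M=\mathcal L\}$ with $\mathcal L=\begin{pmatrix}\mathbf 1_L&0\\0&-\mathbf 1_L\end{pmatrix}$, with the topology induced by $\mathcal M_{2L}(\mathbb C)$. Let $(U_n,V_n)_{n\in\mathbb Z}$ be the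 coordinate maps on $\Omega=(\mathrm U(L)\times\mathrm U(L))^{\mathbb Z}$, equipped with the product probability measure $\bigotimes_{n\in\mathbb Z}(\nu_L\otimes\nu_L)$, where $\nu_L$ is the normalized Haar measure on $\mathrm U(L)$, and define the transfer matrices $$T(z,\omega)=\begin{pmatrix}V_0(\omega)&0\\0&U_0(\omega)^*\end{pmatrix}\hat T_0(z)\begin{pmatrix}V_1(\omega)&0\\0&U_1(\omega)^*\end{pmatrix}\hat T_1\in\mathrm U(L,L),\qquad\omega\in\Omega.$$ Let $\mu_z$ be the law of $T(z,\cdot)$ on $\mathrm U(L,L)$, and let the Fürstenberg group $G(z)=\overline{\langle\operatorname{supp}\mu_z\rangle}$ be the closure in $\mathrm U(L,L)$ of the subgroup generated by the topological support of $\mu_z$. Then for every $z\in\mathbb S^1$, $$G(z)=\mathrm U(L,L).$$ Likewise the closure in $\mathrm U(L,L)$ of the subgroup generated by all the matrices $T(z,\omega)$, $\omega\in\Omega$, which is the other description of $G(z)$, is $\mathrm U(L,L)$. -/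

import Mathlib

open scoped Matrix MatrixOrder ComplexOrder
open MeasureTheory

namespace ScatteringZipper

/-! ### The unitary group `U(L)` with its Borel structure and normalized Haar measure -/

/-- The unitary group `U(L)`, with the topology induced by `M_L(ℂ)`. -/
abbrev UGroup (L : ℕ) : Type := ↥(Matrix.unitaryGroup (Fin L) ℂ)

noncomputable instance instMeasurableSpaceUGroup (L : ℕ) : MeasurableSpace (UGroup L) := borel _

instance instBorelSpaceUGroup (L : ℕ) : BorelSpace (UGroup L) := ⟨rfl⟩

instance instCompactSpaceUGroup (L : ℕ) : CompactSpace (UGroup L) := by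
  have hK : IsCompact (Set.univ.pi fun _ : Fin L => Set.univ.pi fun _ : Fin L =>
      Metric.closedBall (0 : ℂ) 1) :=
    isCompact_univ_pi fun _ => isCompact_univ_pi fun _ => isCompact_closedBall _ _
  have hc : IsClosed {M : Matrix (Fin L) (Fin L) ℂ | star M * M = 1 ∧ M * star M = 1} :=
    (isClosed_eq (by fun_prop) continuous_const).inter
      (isClosed_eq (by fun_prop) continuous_const)
  refine isCompact_iff_compactSpace.mp (IsCompact.of_isClosed_subset hK hc ?_)
  exact fun M hM i _ j _ => mem_closedBall_zero_iff.mpr (entry_norm_bound_of_unitary hM i j)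

/-- The normalized Haar measure `ν_L` on `U(L)`. -/
noncomputable def haarU (L : ℕ) : Measure (UGroup L) := Measure.haarMeasure ⊤

instance instIsProbabilityMeasureHaarU (L : ℕ) : IsProbabilityMeasure (haarU L) :=
  ⟨by simpa [haarU] using
    Measure.haarMeasure_self (K₀ := (⊤ : TopologicalSpace.PositiveCompacts (UGroup L)))⟩

/-! ### The Lorentz group `U(L,L)` -/

/-- The matrix `diag(1_L, -1_L)` of the form preserved by `U(L,L)`. -/
def form (L : ℕ) : Matrix (Fin L ⊕ Fin L) (Fin L ⊕ Fin L) ℂ := Matrix.fromBlocks 1 0 0 (-1)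

theorem form_mul_form (L : ℕ) : form L * form L = 1 := by
  simp [form, Matrix.fromBlocks_multiply]

theorem form_conjTranspose (L : ℕ) : (form L)ᴴ = form L := by
  simp [form, Matrix.fromBlocks_conjTranspose]

/-- The Lorentz group `U(L,L)`: all complex `2L × 2L` matrices `M` with `M* 𝓛 M = 𝓛`.
It carries the topology induced by `M_{2L}(ℂ)`. -/
def lorentz (L : ℕ) : Submonoid (Matrix (Fin L ⊕ Fin L) (Fin L ⊕ Fin L) ℂ) where
  carrier := {M | Mᴴ * form L * M = form L}
  one_mem' := by simp
  mul_mem' := by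
    intro A B hA hB
    change (A * B)ᴴ * form L * (A * B) = form L
    change Aᴴ * form L * A = form L at hA
    change Bᴴ * form L * B = form L at hB
    calc (A * B)ᴴ * form L * (A * B) = Bᴴ * (Aᴴ * form L * A) * B := by
          simp only [Matrix.conjTranspose_mul, Matrix.mul_assoc]
      _ = form L := by rw [hA, hB]

theorem mem_lorentz {L : ℕ} {M : Matrix (Fin L ⊕ Fin L) (Fin L ⊕ Fin L) ℂ} :
    M ∈ lorentz L ↔ Mᴴ * form L * M = form L := Iff.rfl

theorem lorentz_inv_mul {L : ℕ} {M : Matrix (Fin L ⊕ Fin L) (Fin L ⊕ Fin L) ℂ}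
    (hM : M ∈ lorentz L) : (form L * Mᴴ * form L) * M = 1 := by
  rw [Matrix.mul_assoc, Matrix.mul_assoc, ← Matrix.mul_assoc Mᴴ, mem_lorentz.mp hM,
    form_mul_form]

theorem lorentz_inv_mem {L : ℕ} {M : Matrix (Fin L ⊕ Fin L) (Fin L ⊕ Fin L) ℂ}
    (hM : M ∈ lorentz L) : form L * Mᴴ * form L ∈ lorentz L := by
  have h1 : M * (form L * Mᴴ * form L) = 1 := mul_eq_one_comm.mp (lorentz_inv_mul hM)
  rw [mem_lorentz]
  calc (form L * Mᴴ * form L)ᴴ * form L * (form L * Mᴴ * form L)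
      = form L * M * (form L * form L) * (form L * Mᴴ * form L) := by
        simp only [Matrix.conjTranspose_mul, Matrix.conjTranspose_conjTranspose,
          form_conjTranspose, Matrix.mul_assoc]
    _ = form L * (M * (form L * Mᴴ * form L)) := by
        rw [form_mul_form, Matrix.mul_one, Matrix.mul_assoc]
    _ = form L := by rw [h1, Matrix.mul_one]

/-- The type of elements of `U(L,L)`. -/
abbrev ULL (L : ℕ) : Type := ↥(lorentz L)

/-- The inverse of `M` in `U(L,L)` is the matrix inverse, which is `𝓛 M* 𝓛`. -/
noncomputable instance instInvULL (L : ℕ) : Inv (ULL L) :=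
  ⟨fun M => ⟨form L * (M : Matrix (Fin L ⊕ Fin L) (Fin L ⊕ Fin L) ℂ)ᴴ * form L,
    lorentz_inv_mem M.2⟩⟩

theorem ULL_inv_mul_cancel {L : ℕ} (M : ULL L) : M⁻¹ * M = 1 :=
  Subtype.ext (lorentz_inv_mul M.2)

noncomputable instance instGroupULL (L : ℕ) : Group (ULL L) :=
  { (inferInstance : Monoid (ULL L)), instInvULL L with
    inv_mul_cancel := ULL_inv_mul_cancel }

instance instIsTopologicalGroupULL (L : ℕ) : IsTopologicalGroup (ULL L) where
  continuous_inv := Continuous.subtype_mk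
    (f := fun M : ULL L => form L * (M : Matrix (Fin L ⊕ Fin L) (Fin L ⊕ Fin L) ℂ)ᴴ * form L)
    (by fun_prop) _

noncomputable instance instMeasurableSpaceULL (L : ℕ) : MeasurableSpace (ULL L) := borel _

instance instBorelSpaceULL (L : ℕ) : BorelSpace (ULL L) := ⟨rfl⟩

/-! ### The transfer matrices -/

/-- `ρ(α) = (1 - α α*)^{1/2}`. -/
noncomputable def rho {L : ℕ} (α : Matrix (Fin L) (Fin L) ℂ) : Matrix (Fin L) (Fin L) ℂ :=
  CFC.sqrt (1 - α * αᴴ)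

/-- `ρ̃(α) = (1 - α* α)^{1/2}`. -/
noncomputable def rhoTilde {L : ℕ} (α : Matrix (Fin L) (Fin L) ℂ) : Matrix (Fin L) (Fin L) ℂ :=
  CFC.sqrt (1 - αᴴ * α)

/-- The matrix `T̂₀(z)`. The matrix `T̂₁` is the same expression at `z = 1`. -/
noncomputable def hatT {L : ℕ} (α : Matrix (Fin L) (Fin L) ℂ) (z : Circle) :
    Matrix (Fin L ⊕ Fin L) (Fin L ⊕ Fin L) ℂ :=
  Matrix.fromBlocks
    ((z : ℂ)⁻¹ • (rhoTilde α)⁻¹) ((rhoTilde α)⁻¹ * αᴴ)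
    (α * (rhoTilde α)⁻¹) ((z : ℂ) • (rho α)⁻¹)

/-- The block-diagonal matrix `diag(V, U*)`. -/
def phase {L : ℕ} (U V : UGroup L) : Matrix (Fin L ⊕ Fin L) (Fin L ⊕ Fin L) ℂ :=
  Matrix.fromBlocks (V : Matrix _ _ ℂ) 0 0 ((U : Matrix _ _ ℂ)ᴴ)

theorem phase_mem {L : ℕ} (U V : UGroup L) : phase U V ∈ lorentz L := by
  have hV : (V : Matrix (Fin L) (Fin L) ℂ)ᴴ * V = 1 := V.2.1
  have hU : (U : Matrix (Fin L) (Fin L) ℂ) * (U : Matrix (Fin L) (Fin L) ℂ)ᴴ = 1 := U.2.2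
  rw [mem_lorentz]
  simp [phase, form, Matrix.fromBlocks_multiply, Matrix.fromBlocks_conjTranspose, hV, hU]

section Membership

variable {L : ℕ} {α : Matrix (Fin L) (Fin L) ℂ}

theorem posDef_one_sub_mul_conjTranspose (hα : (1 - αᴴ * α).PosDef) :
    (1 - α * αᴴ).PosDef := by
  have h1 : (1 : Matrix (Fin L) (Fin L) ℂ).PosDef := Matrix.PosDef.one
  have hp : (1 - α * αᴴ).PosSemidef := by
    let _ : Invertible (1 : Matrix (Fin L) (Fin L) ℂ) := invertibleOne
    have h := (h1.fromBlocks₁₁ α 1).mpr (by simpa using hα.posSemidef)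
    simpa using (h1.fromBlocks₂₂ 1 α).mp h
  refine hp.posDef_iff_isUnit.mpr ((Matrix.isUnit_iff_isUnit_det _).mpr ?_)
  rw [Matrix.det_one_sub_mul_comm]
  exact (Matrix.isUnit_iff_isUnit_det _).mp hα.isUnit

theorem rho_mul_rho (hα : (1 - αᴴ * α).PosDef) : rho α * rho α = 1 - α * αᴴ :=
  CFC.sqrt_mul_sqrt_self _ (posDef_one_sub_mul_conjTranspose hα).posSemidef.nonneg

theorem rhoTilde_mul_rhoTilde (hα : (1 - αᴴ * α).PosDef) :
    rhoTilde α * rhoTilde α = 1 - αᴴ * α :=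
  CFC.sqrt_mul_sqrt_self _ hα.posSemidef.nonneg

theorem rho_posDef (hα : (1 - αᴴ * α).PosDef) : (rho α).PosDef := by
  refine (Matrix.nonneg_iff_posSemidef.mp (CFC.sqrt_nonneg (1 - α * αᴴ))).posDef_iff_isUnit.mpr ?_
  have h := posDef_one_sub_mul_conjTranspose hα
  exact (CFC.isUnit_sqrt_iff _ h.posSemidef.nonneg).mpr h.isUnit

theorem rhoTilde_posDef (hα : (1 - αᴴ * α).PosDef) : (rhoTilde α).PosDef := by
  refine (Matrix.nonneg_iff_posSemidef.mp (CFC.sqrt_nonneg (1 - αᴴ * α))).posDef_iff_isUnit.mpr ?_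
  exact (CFC.isUnit_sqrt_iff _ hα.posSemidef.nonneg).mpr hα.isUnit

theorem rho_mul (hα : (1 - αᴴ * α).PosDef) : rho α * α = α * rhoTilde α := by
  set R := Matrix.fromBlocks (rho α) 0 0 (rhoTilde α) with hR
  set N : Matrix (Fin L ⊕ Fin L) (Fin L ⊕ Fin L) ℂ := Matrix.fromBlocks 0 α 0 0 with hN
  have hRp : R.PosSemidef := by
    have := (rho_posDef hα).isUnit.invertible
    have h := ((rho_posDef hα).fromBlocks₁₁ 0 (rhoTilde α)).mpr
      (by simpa using (rhoTilde_posDef hα).posSemidef)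
    simpa [hR] using h
  have hsq : R * R = Matrix.fromBlocks (1 - α * αᴴ) 0 0 (1 - αᴴ * α) := by
    simp [hR, Matrix.fromBlocks_multiply, rho_mul_rho hα, rhoTilde_mul_rhoTilde hα]
  have hcomm : Commute (R * R) N := by
    rw [hsq, hN, Commute, SemiconjBy]
    simp [Matrix.fromBlocks_multiply, sub_mul, mul_sub, Matrix.mul_assoc]
  have hc : Commute R N := by
    rw [← CFC.sqrt_mul_self R hRp.nonneg]
    exact hcomm.cfcₙ_nnreal _
  have h := hc.eq
  simp only [hR, hN, Matrix.fromBlocks_multiply, Matrix.fromBlocks_inj] at h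
  simpa using h.2.1

theorem hatT_mem (hα : (1 - αᴴ * α).PosDef) (z : Circle) : hatT α z ∈ lorentz L := by
  have hdR : IsUnit (rhoTilde α).det :=
    (Matrix.isUnit_iff_isUnit_det _).mp (rhoTilde_posDef hα).isUnit
  have hdS : IsUnit (rho α).det := (Matrix.isUnit_iff_isUnit_det _).mp (rho_posDef hα).isUnit
  have hR : ((rhoTilde α)⁻¹)ᴴ = (rhoTilde α)⁻¹ := (rhoTilde_posDef hα).inv.isHermitian
  have hS : ((rho α)⁻¹)ᴴ = (rho α)⁻¹ := (rho_posDef hα).inv.isHermitian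
  have h1 : α * (rhoTilde α)⁻¹ = (rho α)⁻¹ * α := by
    calc α * (rhoTilde α)⁻¹ = (rho α)⁻¹ * (rho α * α) * (rhoTilde α)⁻¹ := by
          rw [Matrix.nonsing_inv_mul_cancel_left _ _ hdS]
      _ = (rho α)⁻¹ * α := by
          rw [rho_mul hα, ← Matrix.mul_assoc, Matrix.mul_nonsing_inv_cancel_right _ _ hdR]
  have h2 : (rhoTilde α)⁻¹ * αᴴ = αᴴ * (rho α)⁻¹ := by
    have h := congrArg Matrix.conjTranspose h1
    simpa [Matrix.conjTranspose_mul, hR, hS] using h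
  have h3 : (rhoTilde α)⁻¹ * (rhoTilde α)⁻¹
      - (rhoTilde α)⁻¹ * (αᴴ * (α * (rhoTilde α)⁻¹)) = 1 := by
    calc _ = (rhoTilde α)⁻¹ * (1 - αᴴ * α) * (rhoTilde α)⁻¹ := by
          simp only [mul_sub, sub_mul, Matrix.mul_one, Matrix.mul_assoc]
      _ = 1 := by
          rw [← rhoTilde_mul_rhoTilde hα, Matrix.nonsing_inv_mul_cancel_left _ _ hdR,
            Matrix.mul_nonsing_inv _ hdR]
  have h4 : (rho α)⁻¹ * (rho α)⁻¹ - (rho α)⁻¹ * (α * (αᴴ * (rho α)⁻¹)) = 1 := by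
    calc _ = (rho α)⁻¹ * (1 - α * αᴴ) * (rho α)⁻¹ := by
          simp only [mul_sub, sub_mul, Matrix.mul_one, Matrix.mul_assoc]
      _ = 1 := by
          rw [← rho_mul_rho hα, Matrix.nonsing_inv_mul_cancel_left _ _ hdS,
            Matrix.mul_nonsing_inv _ hdS]
  have hz : (z : ℂ) ≠ 0 := z.coe_ne_zero
  have hzc : star (z : ℂ) = (z : ℂ)⁻¹ := by simp [← Circle.coe_inv_eq_conj]
  rw [mem_lorentz, hatT, form]
  generalize (z : ℂ) = w at *
  generalize (rhoTilde α)⁻¹ = R at *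
  generalize (rho α)⁻¹ = S at *
  simp only [Matrix.fromBlocks_conjTranspose, Matrix.fromBlocks_multiply, Matrix.fromBlocks_inj,
    Matrix.conjTranspose_smul, Matrix.conjTranspose_mul, Matrix.conjTranspose_conjTranspose,
    hR, hS, hzc, star_inv₀, inv_inv, Matrix.mul_one, Matrix.mul_zero, add_zero, zero_add,
    Matrix.mul_neg, Matrix.neg_mul, Matrix.smul_mul, Matrix.mul_smul, smul_smul, smul_neg,
    mul_inv_cancel₀ hz, inv_mul_cancel₀ hz, one_smul, Matrix.mul_assoc]
  refine ⟨?_, ?_, ?_, ?_⟩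
  · rw [← sub_eq_add_neg, h3]
  · rw [h2]; simp
  · have h6 : α * (R * R) = S * (α * R) := by
      rw [← Matrix.mul_assoc, h1, Matrix.mul_assoc, h1]
    simp [h6, h1]
  · have h5 : α * (R * (R * αᴴ)) = S * (α * (αᴴ * S)) := by
      rw [h2, ← Matrix.mul_assoc, h1, Matrix.mul_assoc]
    rw [h5, ← h4]; abel

end Membership

/-- The sample space `Ω = (U(L) × U(L))^ℤ`; the `n`-th coordinate of `ω` is `(U_n(ω), V_n(ω))`. -/
abbrev Sample (L : ℕ) : Type := ℤ → UGroup L × UGroup L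

/-- The product probability measure `⊗_{n ∈ ℤ} (ν_L ⊗ ν_L)` on `Ω`. -/
noncomputable def prob (L : ℕ) : Measure (Sample L) :=
  Measure.infinitePi fun _ : ℤ => (haarU L).prod (haarU L)

/-- The transfer matrix
`T(z, ω) = diag(V₀(ω), U₀(ω)*) T̂₀(z) diag(V₁(ω), U₁(ω)*) T̂₁`, an element of `U(L,L)`. -/
noncomputable def transfer {L : ℕ} (α : Matrix (Fin L) (Fin L) ℂ) (hα : (1 - αᴴ * α).PosDef)
    (z : Circle) (ω : Sample L) : ULL L :=
  ⟨phase (ω 0).1 (ω 0).2 * hatT α z * phase (ω 1).1 (ω 1).2 * hatT α 1,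
    mul_mem (mul_mem (mul_mem (phase_mem _ _) (hatT_mem hα z)) (phase_mem _ _)) (hatT_mem hα 1)⟩

/-- The law `μ_z` on `U(L,L)` of the transfer matrices. -/
noncomputable def transferLaw {L : ℕ} (α : Matrix (Fin L) (Fin L) ℂ)
    (hα : (1 - αᴴ * α).PosDef) (z : Circle) : Measure (ULL L) :=
  (prob L).map (transfer α hα z)

/-- The Fürstenberg group `G(z)`: the closure in `U(L,L)` of the subgroup generated by the
topological support of `μ_z`. -/
noncomputable def furstenbergGroup {L : ℕ} (α : Matrix (Fin L) (Fin L) ℂ)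
    (hα : (1 - αᴴ * α).PosDef) (z : Circle) : Subgroup (ULL L) :=
  (Subgroup.closure (transferLaw α hα z).support).topologicalClosure

end ScatteringZipper

/-! Write `T(p, q) = P(p) A P(q) B`, with `A` and `B` the elements given by `T̂₀(z)` and `T̂₁`, and
with `P(p)`, `P(q)` ranging independently over the group `K` of block-diagonal unitaries. The
quotients `T(p, 1) T(1, 1)⁻¹ = P(p)` and `T(1, 1)⁻¹ T(1, q) = B⁻¹ P(q) B` show that the generated
group `H` contains `K` and `B⁻¹ K B`; neither depends on `z`.

Since `α ≠ 0`, `B` is not in `K`, so its Cartan decomposition `B = k · hyp t · k'` has `t ≠ 0`, and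
`H` contains `hyp (-t) K hyp t`. Conjugating a diagonal phase that differs from 1 in a single entry
gives elements whose Cartan part is a small one-coordinate `hyp`, of arbitrary size up to a bound.
Permutations, powers and products then give every `hyp s`, so `H` is everything by
`exists_cartanDecomposition` (`eq_top_of_conj_phaseULL_mem`). No closure is needed.

Haar measure charges nonempty open sets and `transfer` is continuous, so every transfer matrix lies
in the support of the law. -/

/-- **Singular value decomposition** of a square complex matrix. -/
theorem Matrix.exists_singularValueDecomposition {n : Type*} [Fintype n] [DecidableEq n]
    (c : Matrix n n ℂ) :
    ∃ (W X : Matrix.unitaryGroup n ℂ) (s : n → ℝ),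
      c = (W : Matrix n n ℂ) * Matrix.diagonal (fun i => (s i : ℂ)) * (X : Matrix n n ℂ) := by
  have hps := Matrix.posSemidef_conjTranspose_mul_self c
  have hH := hps.isHermitian
  set l := hH.eigenvalues with hl
  set Y := hH.eigenvectorUnitary with hY
  have hYs : (Y : Matrix n n ℂ)ᴴ * (Y : Matrix n n ℂ) = 1 := Y.2.1
  have hYs' : (Y : Matrix n n ℂ) * (Y : Matrix n n ℂ)ᴴ = 1 := Y.2.2
  set d := c * (Y : Matrix n n ℂ) with hd
  have hdd : dᴴ * d = Matrix.diagonal (fun i => (l i : ℂ)) := by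
    have h := hH.spectral_theorem
    rw [Unitary.conjStarAlgAut_apply] at h
    change cᴴ * c = (Y : Matrix n n ℂ) * _ * (Y : Matrix n n ℂ)ᴴ at h
    rw [hd, Matrix.conjTranspose_mul, Matrix.mul_assoc, ← Matrix.mul_assoc cᴴ, h]
    simp only [Matrix.mul_assoc, hYs, Matrix.mul_one]
    rw [← Matrix.mul_assoc, hYs, Matrix.one_mul]
    rfl
  have hl0 : ∀ i, 0 ≤ l i := hps.eigenvalues_nonneg
  have hsum : ∀ i j, ∑ k, star (d k i) * d k j = if i = j then (l i : ℂ) else 0 := by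
    intro i j
    have := congrFun (congrFun hdd i) j
    simpa [Matrix.mul_apply, Matrix.diagonal_apply] using this
  -- The columns of `d` are orthogonal with squared norms `l i`. The nonzero ones are normalized and
  -- completed to an orthonormal basis, whose vectors are the columns of `W`.
  let v : n → EuclideanSpace ℂ n := fun i => WithLp.toLp 2 fun k => ((√(l i) : ℝ) : ℂ)⁻¹ * d k i
  have hv : Orthonormal ℂ ({i | l i ≠ 0}.domRestrict v) := by
    rw [orthonormal_iff_ite]
    rintro ⟨i, hi⟩ ⟨j, hj⟩
    have hi0 : ((√(l i) : ℝ) : ℂ) ≠ 0 := by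
      simpa [Real.sqrt_eq_zero (hl0 i)] using hi
    have hsq : ((√(l i) : ℝ) : ℂ) * ((√(l i) : ℝ) : ℂ) = l i := by
      exact_mod_cast Real.mul_self_sqrt (hl0 i)
    have : inner ℂ (v i) (v j)
        = ((√(l i) : ℝ) : ℂ)⁻¹ * ((√(l j) : ℝ) : ℂ)⁻¹ * ∑ k, star (d k i) * d k j := by
      simp only [v, PiLp.inner_apply, Finset.mul_sum, RCLike.inner_apply, map_mul, map_inv₀,
        Complex.conj_ofReal]
      refine Finset.sum_congr rfl fun k _ => ?_
      rw [starRingEnd_apply]; ring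
    change inner ℂ (v i) (v j) = _
    rw [this, hsum]
    by_cases hij : i = j
    · subst hij
      simp only [if_true]
      rw [← hsq]; field_simp
    · simp [hij]
  obtain ⟨b, hb⟩ := hv.exists_orthonormalBasis_extension_of_card_eq (by simp)
  let W : Matrix n n ℂ := Matrix.of fun k i => b i k
  have hW : W ∈ Matrix.unitaryGroup n ℂ := by
    rw [Matrix.mem_unitaryGroup_iff']
    ext i j
    have := orthonormal_iff_ite.mp b.orthonormal i j
    rw [PiLp.inner_apply] at this
    simpa [W, Matrix.star_eq_conjTranspose, Matrix.mul_apply, Matrix.one_apply, mul_comm] using this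
  refine ⟨⟨W, hW⟩, Y⁻¹, fun i => √(l i), ?_⟩
  have hdW : d = W * Matrix.diagonal (fun i => ((√(l i) : ℝ) : ℂ)) := by
    ext k i
    rw [Matrix.mul_diagonal]
    by_cases hi : l i = 0
    · have h := hsum i i
      simp only [if_true, hi, Complex.ofReal_zero] at h
      rw [Finset.sum_eq_zero_iff_of_nonneg (fun k _ => star_mul_self_nonneg _)] at h
      have := h k (Finset.mem_univ _)
      simp only [mul_eq_zero, star_eq_zero, or_self] at this
      simp [this, hi]
    · have hi0 : ((√(l i) : ℝ) : ℂ) ≠ 0 := by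
        simpa [Real.sqrt_eq_zero (hl0 i)] using hi
      simp only [W, Matrix.of_apply, hb i hi, v]
      field_simp
  change c = W * _ * (Y : Matrix n n ℂ)ᴴ
  rw [← hdW, hd, Matrix.mul_assoc, hYs', Matrix.mul_one]

/-! ### Full support of the product measure and of its image -/

/-- A product of probability measures that are positive on nonempty open sets is positive on
nonempty open sets. -/
theorem isOpenPosMeasure_infinitePi {ι : Type*} {X : ι → Type*} [∀ i, TopologicalSpace (X i)]
    [∀ i, MeasurableSpace (X i)] [∀ i, OpensMeasurableSpace (X i)] (μ : ∀ i, Measure (X i))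
    [∀ i, IsProbabilityMeasure (μ i)] [∀ i, (μ i).IsOpenPosMeasure] :
    (Measure.infinitePi μ).IsOpenPosMeasure := by
  refine ⟨fun U hU ⟨x, hx⟩ => ?_⟩
  obtain ⟨s, t, ht, hst⟩ := isOpen_pi_iff.mp hU x hx
  refine ne_of_gt (lt_of_lt_of_le ?_ (measure_mono hst))
  rw [Measure.infinitePi_pi μ (fun i hi => (ht i hi).1.measurableSet)]
  exact CanonicallyOrderedAdd.prod_pos.mpr fun i hi => (ht i hi).1.measure_pos _ ⟨x i, (ht i hi).2⟩

theorem Continuous.range_subset_support_map {X Y : Type*} [TopologicalSpace X] [MeasurableSpace X]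
    [OpensMeasurableSpace X] [TopologicalSpace Y] [MeasurableSpace Y] [BorelSpace Y]
    {μ : Measure X} [μ.IsOpenPosMeasure] {f : X → Y} (hf : Continuous f) :
    Set.range f ⊆ (μ.map f).support := by
  rintro _ ⟨x, rfl⟩
  rw [Measure.mem_support_iff_forall]
  intro U hU
  exact (Measure.measure_pos_of_mem_nhds μ (hf.continuousAt hU)).trans_le
    (Measure.le_map_apply hf.aemeasurable U)

namespace ScatteringZipper

instance instSecondCountableTopologyUGroup (L : ℕ) : SecondCountableTopology (UGroup L) :=
  have : SecondCountableTopology (Matrix (Fin L) (Fin L) ℂ) :=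
    inferInstanceAs (SecondCountableTopology (Fin L → Fin L → ℂ))
  TopologicalSpace.Subtype.secondCountableTopology _

instance instIsOpenPosMeasureHaarU (L : ℕ) : (haarU L).IsOpenPosMeasure :=
  inferInstanceAs (Measure.haarMeasure _).IsOpenPosMeasure

instance instIsOpenPosMeasureProb (L : ℕ) : (prob L).IsOpenPosMeasure :=
  isOpenPosMeasure_infinitePi _

theorem continuous_transfer {L : ℕ} (α : Matrix (Fin L) (Fin L) ℂ) (hα : (1 - αᴴ * α).PosDef)
    (z : Circle) : Continuous (transfer α hα z) := by
  refine Continuous.subtype_mk ?_ _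
  have h : ∀ n : ℤ, Continuous fun ω : Sample L => phase (ω n).1 (ω n).2 := fun n =>
    Continuous.matrix_fromBlocks (by fun_prop) continuous_const continuous_const (by fun_prop)
  exact (((h 0).mul continuous_const).mul (h 1)).mul continuous_const

theorem range_transfer_subset_support {L : ℕ} (α : Matrix (Fin L) (Fin L) ℂ)
    (hα : (1 - αᴴ * α).PosDef) (z : Circle) :
    Set.range (transfer α hα z) ⊆ (transferLaw α hα z).support :=
  (continuous_transfer α hα z).range_subset_support_map

end ScatteringZipper

namespace ScatteringZipper

/-! ### Block-diagonal and hyperbolic elements -/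

variable {L : ℕ}

/-- `diag(V, U*)` as an element of `U(L,L)`. -/
def phaseULL (U V : UGroup L) : ULL L := ⟨phase U V, phase_mem U V⟩

theorem phaseULL_mul (U V U' V' : UGroup L) :
    phaseULL U V * phaseULL U' V' = phaseULL (U' * U) (V * V') := by
  refine Subtype.ext ?_
  simp [phaseULL, phase, Matrix.fromBlocks_multiply]

theorem phaseULL_one : phaseULL (1 : UGroup L) 1 = 1 :=
  Subtype.ext (by simp [phaseULL, phase])

theorem phaseULL_inv (U V : UGroup L) : (phaseULL U V)⁻¹ = phaseULL U⁻¹ V⁻¹ := by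
  rw [inv_eq_iff_mul_eq_one, phaseULL_mul]
  simp [phaseULL_one]

/-- The hyperbolic element with blocks `diag(cosh t)` and `diag(sinh t)`. -/
noncomputable def hyp (t : Fin L → ℝ) : ULL L :=
  ⟨Matrix.fromBlocks (Matrix.diagonal fun i => (Real.cosh (t i) : ℂ))
      (Matrix.diagonal fun i => (Real.sinh (t i) : ℂ))
      (Matrix.diagonal fun i => (Real.sinh (t i) : ℂ))
      (Matrix.diagonal fun i => (Real.cosh (t i) : ℂ)), by
    have h (i : Fin L) : (Real.cosh (t i) : ℂ) * (Real.cosh (t i) : ℂ)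
        - (Real.sinh (t i) : ℂ) * (Real.sinh (t i) : ℂ) = 1 := by
      have := Real.cosh_sq_sub_sinh_sq (t i)
      rw [← sq, ← sq]
      exact_mod_cast this
    have hs (f : ℝ → ℝ) : star (fun i => (f (t i) : ℂ)) = fun i => (f (t i) : ℂ) := by
      ext i; simp
    rw [mem_lorentz, form]
    simp only [Matrix.fromBlocks_conjTranspose, Matrix.fromBlocks_multiply,
      Matrix.diagonal_conjTranspose, hs, Matrix.mul_one, Matrix.mul_zero, add_zero, zero_add,
      Matrix.mul_neg, Matrix.neg_mul, Matrix.diagonal_mul_diagonal, Matrix.fromBlocks_inj]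
    refine ⟨?_, ?_, ?_, ?_⟩
    · rw [← sub_eq_add_neg, Matrix.diagonal_sub]; simp only [h, Matrix.diagonal_one]
    · simp [mul_comm]
    · simp [mul_comm]
    · rw [← sub_eq_add_neg, ← neg_sub, Matrix.diagonal_sub]
      simp only [h, Matrix.diagonal_one]⟩

theorem hyp_add (s t : Fin L → ℝ) : hyp (s + t) = hyp s * hyp t := by
  refine Subtype.ext ?_
  simp only [hyp, Submonoid.coe_mul, Matrix.fromBlocks_multiply, Matrix.diagonal_mul_diagonal,
    Matrix.diagonal_add, Pi.add_apply, Real.cosh_add, Real.sinh_add, Complex.ofReal_add,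
    Complex.ofReal_mul, Matrix.fromBlocks_inj]
  simp [add_comm]

theorem hyp_zero : hyp (0 : Fin L → ℝ) = 1 :=
  Subtype.ext (by simp [hyp])

theorem hyp_neg (t : Fin L → ℝ) : hyp (-t) = (hyp t)⁻¹ := by
  rw [eq_inv_iff_mul_eq_one, ← hyp_add, neg_add_cancel, hyp_zero]

/-! ### Cartan decomposition of `U(L,L)` -/

theorem toBlocks₁₁_mul_self (M : ULL L) :
    M.1.toBlocks₁₁ᴴ * M.1.toBlocks₁₁ = 1 + M.1.toBlocks₂₁ᴴ * M.1.toBlocks₂₁ := by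
  have h := mem_lorentz.mp M.2
  rw [← Matrix.fromBlocks_toBlocks M.1] at h
  simp only [form, Matrix.fromBlocks_conjTranspose, Matrix.fromBlocks_multiply,
    Matrix.fromBlocks_inj, Matrix.mul_one, Matrix.mul_zero, add_zero, zero_add, Matrix.mul_neg,
    Matrix.neg_mul] at h
  exact sub_eq_iff_eq_add.mp ((sub_eq_add_neg _ _).trans h.1)

/-- Two elements of `U(L,L)` with the same left block column differ by a unitary in the lower
right block. -/
theorem exists_eq_mul_phaseULL (M N : ULL L) (h₁ : M.1.toBlocks₁₁ = N.1.toBlocks₁₁)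
    (h₂ : M.1.toBlocks₂₁ = N.1.toBlocks₂₁) : ∃ U : UGroup L, M = N * phaseULL U 1 := by
  set E : Matrix (Fin L ⊕ Fin L) (Fin L ⊕ Fin L) ℂ := Matrix.fromBlocks 1 0 0 0 with hE
  have hMN : M.1 * E = N.1 * E := by
    rw [← Matrix.fromBlocks_toBlocks M.1, ← Matrix.fromBlocks_toBlocks N.1, hE]
    simp [Matrix.fromBlocks_multiply, h₁, h₂]
  set Q : ULL L := N⁻¹ * M with hQ
  have hQE : Q.1 * E = E := by
    rw [hQ, Submonoid.coe_mul, Matrix.mul_assoc, hMN, ← Matrix.mul_assoc, ← Submonoid.coe_mul,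
      inv_mul_cancel, Submonoid.coe_one, Matrix.one_mul]
  have hQl := mem_lorentz.mp Q.2
  -- `Q` has left block column `(1, 0)`; preserving the form then forces its upper right block to
  -- vanish and its lower right block to be unitary.
  rw [← Matrix.fromBlocks_toBlocks Q.1] at hQE hQl
  simp only [hE, Matrix.fromBlocks_multiply, Matrix.fromBlocks_inj, Matrix.mul_one,
    Matrix.mul_zero, add_zero] at hQE
  simp only [hQE.1, hQE.2.2.1, form, Matrix.fromBlocks_conjTranspose, Matrix.fromBlocks_multiply,
    Matrix.fromBlocks_inj, Matrix.mul_one, Matrix.mul_zero, add_zero, zero_add, Matrix.mul_neg,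
    Matrix.neg_mul, Matrix.conjTranspose_one, Matrix.conjTranspose_zero, Matrix.one_mul,
    Matrix.zero_mul] at hQl
  obtain ⟨-, hx, -, hy⟩ := hQl
  rw [neg_zero, add_zero] at hx
  rw [hx, Matrix.mul_zero, zero_add, neg_inj] at hy
  let y : UGroup L := ⟨Q.1.toBlocks₂₂, Matrix.mem_unitaryGroup_iff'.mpr hy⟩
  refine ⟨y⁻¹, ?_⟩
  rw [← inv_mul_eq_iff_eq_mul, ← hQ]
  refine Subtype.ext ?_
  rw [← Matrix.fromBlocks_toBlocks Q.1, hQE.1, hQE.2.2.1, hx]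
  change _ = Matrix.fromBlocks _ _ _ ((Q.1.toBlocks₂₂)ᴴᴴ)
  rw [Matrix.conjTranspose_conjTranspose]
  rfl

/-- A singular value decomposition of the lower left block of `M ∈ U(L,L)` yields a Cartan
decomposition of `M`. -/
theorem exists_eq_phaseULL_mul_hyp_mul_phaseULL (M : ULL L) (W X : UGroup L) (t : Fin L → ℝ)
    (h : M.1.toBlocks₂₁ = (W : Matrix (Fin L) (Fin L) ℂ)
      * Matrix.diagonal (fun i => (Real.sinh (t i) : ℂ)) * (X : Matrix (Fin L) (Fin L) ℂ)) :
    ∃ U V U' V' : UGroup L, M = phaseULL U V * hyp t * phaseULL U' V' := by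
  have hW : (W : Matrix (Fin L) (Fin L) ℂ)ᴴ * (W : Matrix (Fin L) (Fin L) ℂ) = 1 := W.2.1
  have hX : (X : Matrix (Fin L) (Fin L) ℂ) * (X : Matrix (Fin L) (Fin L) ℂ)ᴴ = 1 := X.2.2
  set C : Matrix (Fin L) (Fin L) ℂ := Matrix.diagonal fun i => (Real.cosh (t i) : ℂ) with hC
  set S : Matrix (Fin L) (Fin L) ℂ := Matrix.diagonal fun i => (Real.sinh (t i) : ℂ) with hS
  set C' : Matrix (Fin L) (Fin L) ℂ := Matrix.diagonal fun i => (Real.cosh (t i) : ℂ)⁻¹ with hC'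
  have hcosh (i : Fin L) : (Real.cosh (t i) : ℂ) ≠ 0 := by
    exact_mod_cast (Real.cosh_pos (t i)).ne'
  have hCC' : C' * C = 1 := by
    simp only [hC, hC', Matrix.diagonal_mul_diagonal, inv_mul_cancel₀ (hcosh _),
      Matrix.diagonal_one]
  have hCC'' : C * C' = 1 := mul_eq_one_comm.mp hCC'
  have hSH : Sᴴ = S := by
    rw [hS, Matrix.diagonal_conjTranspose]; congr 1; ext i; simp [-Complex.ofReal_sinh, -Complex.ofReal_cosh]
  have hCH : C'ᴴ = C' := by
    rw [hC', Matrix.diagonal_conjTranspose]; congr 1; ext i; simp [-Complex.ofReal_sinh, -Complex.ofReal_cosh]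
  have hCS : 1 + S * S = C * C := by
    rw [hS, hC, Matrix.diagonal_mul_diagonal, Matrix.diagonal_mul_diagonal, ← Matrix.diagonal_one,
      Matrix.diagonal_add]
    congr 1; ext i
    have := Real.cosh_sq' (t i)
    rw [← sq, ← sq]; exact_mod_cast this.symm
  have ha := toBlocks₁₁_mul_self M
  set a := M.1.toBlocks₁₁ with hadef
  -- The target form requires `a = U C X`, which dictates `U`; it is unitary because `aᴴ a = 1 + Xᴴ
  -- S² X = Xᴴ C² X`.
  have hU : a * (X : Matrix (Fin L) (Fin L) ℂ)ᴴ * C' ∈ Matrix.unitaryGroup (Fin L) ℂ := by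
    rw [Matrix.mem_unitaryGroup_iff', Matrix.star_eq_conjTranspose]
    generalize (X : Matrix (Fin L) (Fin L) ℂ) = x at *
    generalize (W : Matrix (Fin L) (Fin L) ℂ) = w at *
    calc (a * xᴴ * C')ᴴ * (a * xᴴ * C') = C' * (x * (aᴴ * a) * xᴴ) * C' := by
          simp only [Matrix.conjTranspose_mul, Matrix.conjTranspose_conjTranspose, hCH,
            Matrix.mul_assoc]
      _ = C' * (x * xᴴ + (x * xᴴ) * S * (wᴴ * w) * S * (x * xᴴ)) * C' := by
          rw [ha, h]
          simp only [Matrix.conjTranspose_mul, hSH, Matrix.mul_add, Matrix.add_mul,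
            Matrix.mul_one, Matrix.mul_assoc]
      _ = 1 := by
          rw [hX, hW, Matrix.one_mul, Matrix.mul_one, Matrix.mul_one, hCS, ← Matrix.mul_assoc,
            hCC', Matrix.one_mul, hCC'']
  let U : UGroup L := ⟨_, hU⟩
  obtain ⟨Y, hY⟩ := exists_eq_mul_phaseULL (M * phaseULL 1 X⁻¹) (phaseULL W⁻¹ U * hyp t)
    (by
      have : (a * (X : Matrix (Fin L) (Fin L) ℂ)ᴴ) = a * (X : Matrix (Fin L) (Fin L) ℂ)ᴴ * C' * C := by
        rw [Matrix.mul_assoc _ C', hCC', Matrix.mul_one]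
      simp only [Submonoid.coe_mul, phaseULL, phase, hyp]
      conv_lhs => rw [← Matrix.fromBlocks_toBlocks M.1]
      simp only [Matrix.fromBlocks_multiply, Matrix.toBlocks_fromBlocks₁₁, Matrix.mul_zero,
        Matrix.zero_mul, add_zero]
      exact this)
    (by
      simp only [Submonoid.coe_mul, phaseULL, phase, hyp]
      conv_lhs => rw [← Matrix.fromBlocks_toBlocks M.1]
      simp only [Matrix.fromBlocks_multiply, Matrix.toBlocks_fromBlocks₂₁, Matrix.mul_zero,
        Matrix.zero_mul, add_zero, zero_add, h]
      change _ * (X : Matrix (Fin L) (Fin L) ℂ)ᴴ = (W : Matrix (Fin L) (Fin L) ℂ)ᴴᴴ * S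
      rw [Matrix.mul_assoc, hX, Matrix.mul_one, Matrix.conjTranspose_conjTranspose])
  refine ⟨W⁻¹, U, Y, X, ?_⟩
  have h1 := eq_mul_inv_of_mul_eq hY
  rw [h1, phaseULL_inv, mul_assoc _ (phaseULL Y 1), phaseULL_mul]
  simp

theorem exists_cartanDecomposition (M : ULL L) :
    ∃ (t : Fin L → ℝ) (U V U' V' : UGroup L), M = phaseULL U V * hyp t * phaseULL U' V' := by
  obtain ⟨W, X, s, h⟩ := Matrix.exists_singularValueDecomposition M.1.toBlocks₂₁
  exact ⟨fun i => Real.arsinh (s i), exists_eq_phaseULL_mul_hyp_mul_phaseULL M W X _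
    (by simpa only [Real.sinh_arsinh] using h)⟩

/-- The lower left block determines the double coset modulo block-diagonal unitaries, so membership
passes to the hyperbolic factor. No sign or order is imposed on `t`. -/
theorem hyp_mem_of_mem {H : Subgroup (ULL L)} (hK : ∀ U V, phaseULL U V ∈ H) {M : ULL L}
    (hM : M ∈ H) (W X : UGroup L) (t : Fin L → ℝ)
    (h : M.1.toBlocks₂₁ = (W : Matrix (Fin L) (Fin L) ℂ)
      * Matrix.diagonal (fun i => (Real.sinh (t i) : ℂ)) * (X : Matrix (Fin L) (Fin L) ℂ)) :
    hyp t ∈ H := by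
  obtain ⟨U, V, U', V', rfl⟩ := exists_eq_phaseULL_mul_hyp_mul_phaseULL M W X t h
  rwa [H.mul_mem_cancel_right (hK _ _), H.mul_mem_cancel_left (hK _ _)] at hM

theorem eq_top_of_hyp_mem {H : Subgroup (ULL L)} (hK : ∀ U V, phaseULL U V ∈ H)
    (h : ∀ t, hyp t ∈ H) : H = ⊤ := by
  refine (Subgroup.eq_top_iff' H).mpr fun M => ?_
  obtain ⟨t, U, V, U', V', rfl⟩ := exists_cartanDecomposition M
  exact mul_mem (mul_mem (hK _ _) (h t)) (hK _ _)

/-! ### Generating all hyperbolic elements -/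

/-- The diagonal unitary matrix with the given diagonal. -/
noncomputable def diagonalUnitary (u : Fin L → Circle) : UGroup L :=
  ⟨Matrix.diagonal fun i => (u i : ℂ), by
    rw [Matrix.mem_unitaryGroup_iff', Matrix.star_eq_conjTranspose, Matrix.diagonal_conjTranspose,
      Matrix.diagonal_mul_diagonal, ← Matrix.diagonal_one]
    congr 1; ext i
    simp [← Circle.coe_inv_eq_conj]⟩

/-- The permutation matrix of a permutation, as a unitary matrix. -/
noncomputable def permUnitary (σ : Equiv.Perm (Fin L)) : UGroup L :=
  ⟨σ.permMatrix ℂ, by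
    rw [Matrix.mem_unitaryGroup_iff', Matrix.star_eq_conjTranspose, Matrix.conjTranspose_permMatrix,
      ← Matrix.permMatrix_mul]
    simp⟩

theorem exists_circle_norm_sub_one {x : ℝ} (h0 : 0 ≤ x) (h2 : x ≤ 2) :
    ∃ w : Circle, ‖(w : ℂ) - 1‖ = x := by
  refine ⟨Circle.exp (2 * Real.arcsin (x / 2)), ?_⟩
  rw [Circle.coe_exp, mul_comm, Complex.norm_exp_I_mul_ofReal_sub_one,
    mul_div_cancel_left₀ _ two_ne_zero, Real.sin_arcsin (by linarith) (by linarith)]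
  rw [Real.norm_of_nonneg (by linarith)]; ring

theorem exists_circle_mul_eq {x : ℝ} {y : ℂ} (h : ‖y‖ = |x|) : ∃ u : Circle, y = u * x := by
  rcases eq_or_ne x 0 with rfl | hx
  · exact ⟨1, by simpa using h⟩
  · have hx' : (x : ℂ) ≠ 0 := by exact_mod_cast hx
    refine ⟨⟨y / x, ?_⟩, (div_mul_cancel₀ y hx').symm⟩
    rw [Submonoid.unitSphere]
    simp [h, hx]

/-- The lower left block of `hyp (-t) * diag(V, 1) * hyp t` for diagonal `V`. -/
theorem toBlocks₂₁_hyp_neg_mul_phaseULL_mul_hyp (t : Fin L → ℝ) (u : Fin L → Circle) :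
    (hyp (-t) * phaseULL 1 (diagonalUnitary u) * hyp t).1.toBlocks₂₁
      = Matrix.diagonal fun i =>
        -((u i : ℂ) - 1) * ((Real.sinh (t i) * Real.cosh (t i) : ℝ) : ℂ) := by
  simp only [hyp, phaseULL, phase, diagonalUnitary, Submonoid.coe_mul, Matrix.fromBlocks_multiply,
    Matrix.toBlocks_fromBlocks₂₁, Matrix.mul_zero, add_zero, zero_add, Submonoid.coe_one,
    Matrix.conjTranspose_one, Matrix.mul_one,
    Matrix.diagonal_mul_diagonal, Matrix.diagonal_add]
  congr 1; ext i
  simp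
  ring

/-- Put a phase `w` in entry `i` of `V` and 1 elsewhere: the conjugate has a lower left block with
the single entry `-(w - 1) sinh (t i) cosh (t i)`. As `‖w - 1‖` takes every value in `[0, 2]`, its
modulus can be made `|sinh r|`, whence the bound. -/
theorem hyp_single_mem_of_small {H : Subgroup (ULL L)} (hK : ∀ U V, phaseULL U V ∈ H)
    (t : Fin L → ℝ) (ht : ∀ V, hyp (-t) * phaseULL 1 V * hyp t ∈ H) (i j : Fin L) {r : ℝ}
    (hr : |Real.sinh r| ≤ 2 * |Real.sinh (t i) * Real.cosh (t i)|) (hi : t i ≠ 0) :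
    hyp (Pi.single j r) ∈ H := by
  set κ := Real.sinh (t i) * Real.cosh (t i) with hκ
  have hκ0 : 0 < |κ| := by
    rw [abs_pos, hκ]
    exact mul_ne_zero (by simpa using hi) (Real.cosh_pos _).ne'
  obtain ⟨w, hw⟩ := exists_circle_norm_sub_one (x := |Real.sinh r| / |κ|) (by positivity)
    (by rwa [div_le_iff₀ hκ0])
  obtain ⟨v, hv⟩ := exists_circle_mul_eq (x := Real.sinh r) (y := -((w : ℂ) - 1) * (κ : ℂ)) (by
    rw [norm_mul, norm_neg, hw, Complex.norm_real, Real.norm_eq_abs, div_mul_cancel₀ _ hκ0.ne'])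
  have hmem : hyp (Pi.single i r) ∈ H := by
    refine hyp_mem_of_mem hK (ht (diagonalUnitary (Pi.mulSingle i w)))
      (diagonalUnitary (Pi.mulSingle i v)) 1 _ ?_
    rw [toBlocks₂₁_hyp_neg_mul_phaseULL_mul_hyp]
    simp only [diagonalUnitary, OneMemClass.coe_one, Matrix.mul_one, Matrix.diagonal_mul_diagonal]
    congr 1; ext k
    rcases eq_or_ne k i with rfl | hk
    · simpa [hκ] using hv
    · simp [hk]
  -- Conjugating by the transposition of `i` and `j` moves the entry from `i` to `j`; it is its own
  -- inverse, so it appears on both sides.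
  refine hyp_mem_of_mem hK hmem (permUnitary (Equiv.swap i j)) (permUnitary (Equiv.swap i j)) _ ?_
  simp only [hyp, permUnitary, Matrix.toBlocks_fromBlocks₂₁]
  rw [Equiv.Perm.permMatrix, PEquiv.toMatrix_toPEquiv_mul, PEquiv.mul_toMatrix_toPEquiv,
    Matrix.submatrix_submatrix, Function.comp_id, Function.id_comp, Equiv.symm_swap,
    Matrix.submatrix_diagonal_equiv]
  congr 1; ext k
  simp only [Function.comp_apply, Pi.single_apply, Equiv.swap_apply_eq_iff, Equiv.swap_apply_right]

theorem hyp_mem_of_ne_zero {H : Subgroup (ULL L)} (hK : ∀ U V, phaseULL U V ∈ H)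
    {t : Fin L → ℝ} (h0 : t ≠ 0) (ht : ∀ V, hyp (-t) * phaseULL 1 V * hyp t ∈ H)
    (s : Fin L → ℝ) : hyp s ∈ H := by
  obtain ⟨i, hi⟩ := Function.ne_iff.mp h0
  let A : AddSubgroup (Fin L → ℝ) :=
    { carrier := {s | hyp s ∈ H}
      zero_mem' := by simp [hyp_zero]
      add_mem' := fun {a b} ha hb => by simpa [hyp_add] using H.mul_mem ha hb
      neg_mem' := fun {a} ha => by simpa [hyp_neg] using ha }
  change s ∈ A
  rw [← Finset.univ_sum_single s]
  refine sum_mem fun j _ => ?_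
  have hκ : 0 < 2 * |Real.sinh (t i) * Real.cosh (t i)| := by
    have : Real.sinh (t i) * Real.cosh (t i) ≠ 0 :=
      mul_ne_zero (by simpa using hi) (Real.cosh_pos _).ne'
    positivity
  -- For large `n` the parameter `s j / (n + 1)` is within the range of `hyp_single_mem_of_small`;
  -- the `(n + 1)`-th power restores `s j`.
  have hlim : Filter.Tendsto (fun n : ℕ => |Real.sinh (s j / ((n : ℝ) + 1))|) Filter.atTop
      (nhds 0) := by
    have h1 : Filter.Tendsto (fun n : ℕ => s j / ((n : ℝ) + 1)) Filter.atTop (nhds 0) := by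
      simpa [div_eq_mul_inv] using (tendsto_one_div_add_atTop_nhds_zero_nat (𝕜 := ℝ)).const_mul (s j)
    simpa using ((Real.continuous_sinh.tendsto 0).comp h1).abs
  obtain ⟨n, hn⟩ := (hlim.eventually_le_const hκ).exists
  have hmem : Pi.single j (s j / ((n : ℝ) + 1)) ∈ A := hyp_single_mem_of_small hK t ht i j hn hi
  have := A.nsmul_mem hmem (n + 1)
  rw [← Pi.single_smul] at this
  convert this using 2
  simp only [nsmul_eq_mul]
  push_cast
  field_simp

/-- A subgroup of `U(L,L)` that contains the block-diagonal unitaries and their conjugates by one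
element which is not block-diagonal is the whole group. -/
theorem eq_top_of_conj_phaseULL_mem {H : Subgroup (ULL L)} (hK : ∀ U V, phaseULL U V ∈ H)
    {B : ULL L} (hB : B.1.toBlocks₂₁ ≠ 0) (hc : ∀ U V, B⁻¹ * phaseULL U V * B ∈ H) : H = ⊤ := by
  obtain ⟨t, U, V, U', V', rfl⟩ := exists_cartanDecomposition B
  refine eq_top_of_hyp_mem hK (hyp_mem_of_ne_zero hK (t := t) ?_ fun X => ?_)
  · rintro rfl
    refine hB ?_
    rw [hyp_zero, mul_one, phaseULL_mul]
    simp [phaseULL, phase]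
  -- With `B = k · hyp t · k'`, conjugating `k · diag(X, 1) · k⁻¹` by `B` cancels `k`, and the outer
  -- factors cancel `k'`.
  · have h := mul_mem (mul_mem (hK U' V') (hc (U⁻¹ * 1 * U) (V * X * V⁻¹))) (hK U'⁻¹ V'⁻¹)
    have h1 : phaseULL (U⁻¹ * 1 * U) (V * X * V⁻¹)
        = phaseULL U V * phaseULL 1 X * (phaseULL U V)⁻¹ := by
      rw [phaseULL_inv, phaseULL_mul, phaseULL_mul]
      simp
    rw [h1, ← phaseULL_inv] at h
    convert h using 1
    rw [hyp_neg]
    group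

theorem closure_range_transfer (α : Matrix (Fin L) (Fin L) ℂ) (hα : (1 - αᴴ * α).PosDef)
    (hα0 : α ≠ 0) (z : Circle) : Subgroup.closure (Set.range (transfer α hα z)) = ⊤ := by
  set H := Subgroup.closure (Set.range (transfer α hα z)) with hH
  let A : ULL L := ⟨hatT α z, hatT_mem hα z⟩
  let B : ULL L := ⟨hatT α 1, hatT_mem hα 1⟩
  have hT (p q : UGroup L × UGroup L) : phaseULL p.1 p.2 * A * phaseULL q.1 q.2 * B ∈ H :=
    Subgroup.subset_closure ⟨fun n => if n = 0 then p else q, Subtype.ext rfl⟩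
  refine eq_top_of_conj_phaseULL_mem (B := B) (fun U V => ?_) ?_ fun U V => ?_
  · have h := mul_mem (hT (U, V) 1) (inv_mem (hT 1 1))
    simpa [phaseULL_one, mul_assoc] using h
  · simp only [B, hatT, Matrix.toBlocks_fromBlocks₂₁]
    intro h
    refine hα0 ?_
    have hd := (Matrix.isUnit_iff_isUnit_det _).mp (rhoTilde_posDef hα).isUnit
    simpa [Matrix.nonsing_inv_mul_cancel_right _ _ hd] using congrArg (· * rhoTilde α) h
  · have h := mul_mem (inv_mem (hT 1 1)) (hT 1 (U, V))
    simpa [phaseULL_one, mul_assoc] using h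

end ScatteringZipper

theorem proposition3p1 (L : ℕ) (α : Matrix (Fin L) (Fin L) ℂ)
    (hα : (1 - αᴴ * α).PosDef) (hα0 : α ≠ 0) (z : Circle) :
    ScatteringZipper.furstenbergGroup α hα z = ⊤ ∧
      (Subgroup.closure
        (Set.range (ScatteringZipper.transfer α hα z))).topologicalClosure = ⊤ := by
  have h := ScatteringZipper.closure_range_transfer α hα hα0 z
  refine ⟨?_, top_le_iff.mp (h.ge.trans (Subgroup.le_topologicalClosure _))⟩
  exact top_le_iff.mp (h.ge.trans
    ((Subgroup.closure_mono (ScatteringZipper.range_transfer_subset_support α hα z)).trans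
      (Subgroup.le_topologicalClosure _)))
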